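/- Let $N\ge 2$. For $1\le k\le N-1$ let $\lambda_{(k+1)^2-2}$ be the real $N\times N$ matrix with entries $[\lambda_{(k+1)^2-2}]_{\mu,\nu}=\delta_{k,\mu}\delta_{k+1,\nu}-\delta_{k+1,\mu}\delta_{k,\nu}$. Define maps $\Phi_N$ of $\frac{N(N-1)}2$ real variables inductively by $\Phi_1\equiv 1$ and $$\Phi_N\bigl(\phi_1,\ldots,\phi_{\frac{N(N-1)}2}\bigr)=e^{\phi_1\lambda_2}\,e^{\phi_2\lambda_7}\cdots e^{\phi_{N-1}\lambda_{N^2-2}}\begin{pmatrix}\Phi_{N-1}\bigl(\phi_N,\ldots,\phi_{\frac{N(N-1)}2}\bigr)&0\\0&1\end{pmatrix},$$ where the $k$-th factor of the product of exponentials is $e^{\phi_k\lambda_{(k+1)^2-2}}$. Let $$Q_N=\bigl([0,2\pi]\times[0,\pi]^{N-2}\bigr)\times\bigl([0,2\pi]\times[0,\pi]^{N-3}\bigr)\times\cdots\times\bigl([0,2\pi]\times[0,\pi]\bigr)\times[0,2\pi]\subset\mathbb R^{\frac{N(N-1)}2}.$$ Then $\Phi_N$ maps $Q_N$ into $SO(N)$,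 and $\Phi_N:Q_N\to SO(N)$ is surjective. Moreover, $\Phi_N$ restricts to a ($C^\infty$) diffeomorphism from the interior of $Q_N$ onto its image, which is an open subset of $SO(N)$; here $SO(N)$ carries its usual structure of an embedded submanifold of the space of real $N\times N$ matrices. -/

import Mathlib

open scoped ContDiff

noncomputable section

namespace EulerSO

/-- The real antisymmetric matrix `λ_{j²-1+2k}` of size `N` (for `1 ≤ k ≤ j ≤ N-1`), with entries
`δ_{k,μ} δ_{j+1,ν} - δ_{j+1,μ} δ_{k,ν}`. Rows and columns are numbered `1, …, N` in this formula,
so the element `μ : Fin N` stands for the number `μ + 1`. -/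
def lam (N j k : ℕ) : Matrix (Fin N) (Fin N) ℝ :=
  Matrix.of fun μ ν =>
    (if k = μ.val + 1 ∧ j + 1 = ν.val + 1 then 1 else 0) -
      (if j + 1 = μ.val + 1 ∧ k = ν.val + 1 then 1 else 0)

/-- The number of angles for `SO(n+1)` is `n` more than the number of angles for `SO(n)`. -/
theorem angle_count (n : ℕ) : (n + 1) * (n + 1 - 1) / 2 = n + n * (n - 1) / 2 := by
  rw [Nat.triangle_succ, Nat.add_comm]

/-- The first `n` of the angles `φ_1, φ_2, …` for `SO(n+1)`. -/
def headAngles (n : ℕ) (φ : Fin ((n + 1) * (n + 1 - 1) / 2) → ℝ) : Fin n → ℝ :=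
  fun k => φ (Fin.cast (angle_count n).symm (Fin.castAdd _ k))

/-- The angles `φ_{n+1}, φ_{n+2}, …` for `SO(n+1)`, that is, all but the first `n`. -/
def tailAngles (n : ℕ) (φ : Fin ((n + 1) * (n + 1 - 1) / 2) → ℝ) :
    Fin (n * (n - 1) / 2) → ℝ :=
  fun i => φ (Fin.cast (angle_count n).symm (Fin.natAdd n i))

/-- The block matrix with blocks `A` and `1` on the diagonal. -/
def embed {n : ℕ} (A : Matrix (Fin n) (Fin n) ℝ) : Matrix (Fin (n + 1)) (Fin (n + 1)) ℝ :=
  Matrix.reindex finSumFinEquiv finSumFinEquiv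
    (Matrix.fromBlocks A 0 0 (1 : Matrix (Fin 1) (Fin 1) ℝ))

/-- The ordered product `e^{θ_1 λ_2} ⋯ e^{θ_{N-1} λ_{N²-2}}` with `N = n + 1`, whose factor number
`k` is `e^{θ_k λ_{(k+1)²-2}}`. As `(k+1)² - 2 = k² - 1 + 2k`, the generator is `lam N k k`; the
element `k : Fin n` stands for the number `k + 1`. -/
def rotProd (n : ℕ) (θ : Fin n → ℝ) : Matrix (Fin (n + 1)) (Fin (n + 1)) ℝ :=
  (List.ofFn fun k : Fin n =>
    NormedSpace.exp (θ k • lam (n + 1) (k.val + 1) (k.val + 1))).prod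

/-- The Euler parametrization `Φ_N`, defined on all of `ℝ^{N(N-1)/2}` by the inductive formula
from `Φ_1 = 1`. The value at `N = 0` is irrelevant. -/
def Phi : (N : ℕ) → (Fin (N * (N - 1) / 2) → ℝ) → Matrix (Fin N) (Fin N) ℝ
  | 0, _ => 1
  | 1, _ => 1
  | n + 2, φ => rotProd (n + 1) (headAngles (n + 1) φ) * embed (Phi (n + 1) (tailAngles (n + 1) φ))

/-- The right end points of the sides of the hypercube: `2π, π, …, π` (`N - 1` numbers, only the
first of them `2π`), followed by the right end points for `N - 1`. -/
def angleMax : (N : ℕ) → Fin (N * (N - 1) / 2) → ℝ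
  | 0 => fun _ => 0
  | n + 1 => fun i =>
      Fin.append (fun k : Fin n => if k.val = 0 then 2 * Real.pi else Real.pi) (angleMax n)
        (Fin.cast (angle_count n) i)

/-- The hypercube `([0,2π] × [0,π]^{N-2}) × ([0,2π] × [0,π]^{N-3}) × ⋯ × [0,2π]`. -/
def hypercube (N : ℕ) : Set (Fin (N * (N - 1) / 2) → ℝ) :=
  Set.univ.pi fun i => Set.Icc 0 (angleMax N i)

/-- Smoothness of a map on an arbitrary subset `X` of a normed space: near every point of `X`, the
map agrees on `X` with a smooth map that is defined on an open set of the ambient space. If `X` is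
an embedded submanifold, this is smoothness for its submanifold structure. -/
def SmoothOnSubset {E F : Type*} [NormedAddCommGroup E] [NormedSpace ℝ E]
    [NormedAddCommGroup F] [NormedSpace ℝ F] (f : E → F) (X : Set E) : Prop :=
  ∀ x ∈ X, ∃ U : Set E, IsOpen U ∧ x ∈ U ∧
    ∃ g : E → F, ContDiffOn ℝ ∞ g U ∧ Set.EqOn g f (U ∩ X)

/-- `f` restricts to a diffeomorphism from `X` onto `Y`: a bijection that is smooth and has a
smooth inverse. -/
def IsDiffeoBetween {E F : Type*} [NormedAddCommGroup E] [NormedSpace ℝ E]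
    [NormedAddCommGroup F] [NormedSpace ℝ F] (f : E → F) (X : Set E) (Y : Set F) : Prop :=
  Set.BijOn f X Y ∧ SmoothOnSubset f X ∧
    ∃ g : F → E, Set.InvOn g f X Y ∧ SmoothOnSubset g Y

/-- The group `SO(N)`, as a subset of the space of real `N × N` matrices. -/
def SO (N : ℕ) : Set (Matrix (Fin N) (Fin N) ℝ) :=
  Matrix.specialOrthogonalGroup (Fin N) ℝ

end EulerSO

end

attribute [local instance] Matrix.normedAddCommGroup Matrix.normedSpace

noncomputable section

namespace EulerSO

open Matrix

/-! Taking the last column maps `SO(n+1)` to the sphere `S^n`, and two elements with the same last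
column differ by a right factor from the embedded `SO(n)` (`mul_embed_unembed`). Right
multiplication by an embedded block does not change the last column, and the last column of
`rotProd` is the point with spherical coordinates `θ` (`rotProd_apply_last`). So `Phi` is spherical
coordinates on the base combined with the previous `Phi` on the fibre. Surjectivity follows by
induction from that of spherical coordinates (`sph_surj`). On the interior the inverse is explicit:
the first angles are read off the last column, the rotation they define is removed, and the smaller
inverse is applied to the remaining block (`hasSmoothInverse_sph`, `hasSmoothInverse_Phi`). All
inverses are smooth on open sets of the ambient space, so no inverse function theorem is needed. -/

/-! ### Exponentials of the generators. -/

/-- Rodrigues' formula in a Banach algebra. -/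
theorem exp_smul_of_cube_eq_neg {A : Type*} [NormedRing A] [NormedAlgebra ℝ A] [CompleteSpace A]
    {a : A} (ha : a * a * a = -a) (t : ℝ) :
    NormedSpace.exp (t • a) = 1 + Real.sin t • a + (1 - Real.cos t) • (a * a) := by
  -- `exp(-s a)` times the claimed value is constant, so the claimed value is a right inverse of
  -- `exp(-t a)`; `exp(t a)` is a left inverse.
  have hF : ∀ s : ℝ, HasDerivAt
      (fun s : ℝ => NormedSpace.exp ((-s) • a) *
        (1 + Real.sin s • a + (1 - Real.cos s) • (a * a))) 0 s := by
    intro s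
    have h1 : HasDerivAt (fun s : ℝ => NormedSpace.exp ((-s) • a))
        ((-1 : ℝ) • (NormedSpace.exp ((-s) • a) * a)) s :=
      (hasDerivAt_exp_smul_const (𝕂 := ℝ) a (-s)).scomp s (hasDerivAt_neg s)
    have h2 : HasDerivAt (fun s : ℝ => 1 + Real.sin s • a + (1 - Real.cos s) • (a * a))
        (Real.cos s • a + Real.sin s • (a * a)) s := by
      have := (((Real.hasDerivAt_sin s).smul_const a).const_add (1 : A)).add
        (((Real.hasDerivAt_cos s).const_sub 1).smul_const (a * a))
      rw [neg_neg] at this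
      exact this
    have hc : a * (1 + Real.sin s • a + (1 - Real.cos s) • (a * a)) =
        Real.cos s • a + Real.sin s • (a * a) := by
      rw [mul_add, mul_add, mul_one, mul_smul_comm, mul_smul_comm, ← mul_assoc a a a, ha]
      module
    refine (h1.mul h2).congr_deriv ?_
    rw [neg_one_smul, neg_mul, mul_assoc, hc, neg_add_cancel]
  have hconst := is_const_of_deriv_eq_zero (fun s => (hF s).differentiableAt)
    (fun s => (hF s).deriv) t 0
  simp only [neg_zero, zero_smul, NormedSpace.exp_zero, Real.sin_zero, Real.cos_zero, sub_self,
    add_zero, mul_one] at hconst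
  have hinv : NormedSpace.exp (t • a) * NormedSpace.exp ((-t) • a) = 1 := by
    rw [← NormedSpace.exp_add_of_commute_of_mem_ball (𝕂 := ℝ)] <;>
      simp [NormedSpace.expSeries_radius_eq_top, Commute, SemiconjBy]
  rw [← left_inv_eq_right_inv hinv hconst]

theorem lam_cube (N k : ℕ) (hk : 1 ≤ k) (hkN : k < N) :
    lam N k k * lam N k k * lam N k k = -lam N k k := by
  have h : lam N k k = Matrix.single ⟨k - 1, by omega⟩ ⟨k, hkN⟩ 1 -
      Matrix.single ⟨k, hkN⟩ ⟨k - 1, by omega⟩ 1 := by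
    ext i j
    simp only [lam, Matrix.of_apply, Matrix.sub_apply, Matrix.single_apply, Fin.ext_iff]
    congr 2 <;> apply propext <;> constructor <;> rintro ⟨h1, h2⟩ <;> omega
  have h1 : (⟨k - 1, by omega⟩ : Fin N) ≠ ⟨k, hkN⟩ := by simp [Fin.ext_iff]; omega
  rw [h]
  simp [sub_mul, mul_sub, h1, h1.symm, neg_add_eq_sub]

/-- The rotation `e^{t λ_{(k+1)²-2}}` as a trigonometric polynomial. -/
def rot (N k : ℕ) (t : ℝ) : Matrix (Fin N) (Fin N) ℝ :=
  1 + Real.sin t • lam N k k + (1 - Real.cos t) • (lam N k k * lam N k k)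

theorem exp_smul_lam {N k : ℕ} (hk : 1 ≤ k) (hkN : k < N) (t : ℝ) :
    NormedSpace.exp (t • lam N k k) = rot N k t := by
  -- The exponential depends only on the topology, so a submultiplicative norm may be chosen for
  -- this proof alone.
  let _ : NormedRing (Matrix (Fin N) (Fin N) ℝ) := Matrix.linftyOpNormedRing
  let _ : NormedAlgebra ℝ (Matrix (Fin N) (Fin N) ℝ) := Matrix.linftyOpNormedAlgebra
  refine @exp_smul_of_cube_eq_neg _ _ _ ?_ _ (lam_cube N k hk hkN) t
  exact inferInstanceAs (CompleteSpace (Fin N → Fin N → ℝ))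

theorem lam_transpose (N k : ℕ) : (lam N k k)ᵀ = -lam N k k := by
  ext i j
  simp [lam, and_comm]

theorem mem_SO_iff {N : ℕ} {A : Matrix (Fin N) (Fin N) ℝ} :
    A ∈ SO N ↔ Aᵀ * A = 1 ∧ A.det = 1 := by
  change A ∈ Matrix.specialOrthogonalGroup (Fin N) ℝ ↔ _
  rw [Matrix.mem_specialOrthogonalGroup_iff, Matrix.mem_orthogonalGroup_iff']

theorem mul_mem_SO {N : ℕ} {A B : Matrix (Fin N) (Fin N) ℝ} (hA : A ∈ SO N) (hB : B ∈ SO N) :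
    A * B ∈ SO N :=
  Submonoid.mul_mem (Matrix.specialOrthogonalGroup (Fin N) ℝ) hA hB

theorem transpose_mem_SO {N : ℕ} {A : Matrix (Fin N) (Fin N) ℝ} (hA : A ∈ SO N) :
    Aᵀ ∈ SO N := by
  rw [mem_SO_iff] at *
  exact ⟨by rw [transpose_transpose]; exact mul_eq_one_comm.1 hA.1, by rw [det_transpose, hA.2]⟩

theorem exp_smul_lam_mem_SO (N k : ℕ) (t : ℝ) : NormedSpace.exp (t • lam N k k) ∈ SO N := by
  have key : ∀ s : ℝ, (NormedSpace.exp (s • lam N k k))ᵀ * NormedSpace.exp (s • lam N k k) = 1 := by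
    intro s
    rw [← Matrix.exp_transpose, transpose_smul, lam_transpose, smul_neg, Matrix.exp_neg]
    exact Matrix.nonsing_inv_mul _ ((Matrix.isUnit_iff_isUnit_det _).1 (Matrix.isUnit_exp _))
  rw [mem_SO_iff]
  refine ⟨key t, ?_⟩
  -- Orthogonality leaves the sign of the determinant open; as the square of `exp((t/2) λ)`, the
  -- matrix has determinant `1`.
  have h2 : t • lam N k k = (t / 2) • lam N k k + (t / 2) • lam N k k := by
    rw [← add_smul, add_halves]
  have h3 := congrArg det (key (t / 2))
  rw [det_mul, det_transpose, det_one] at h3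
  rw [h2, Matrix.exp_add_of_commute _ _ (Commute.refl _), det_mul, h3]

theorem rotProd_mem_SO (n : ℕ) (θ : Fin n → ℝ) : rotProd n θ ∈ SO (n + 1) := by
  refine list_prod_mem (S := Matrix.specialOrthogonalGroup (Fin (n + 1)) ℝ) fun A hA => ?_
  obtain ⟨k, rfl⟩ := (List.mem_ofFn' _ _).1 hA
  exact exp_smul_lam_mem_SO _ _ _

/-! ### The block embedding of `SO(n)` in `SO(n+1)`. -/

section embed

variable {n : ℕ}

@[simp] theorem embed_castSucc_castSucc (A : Matrix (Fin n) (Fin n) ℝ) (i j : Fin n) :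
    embed A i.castSucc j.castSucc = A i j := by
  change embed A (Fin.castAdd 1 i) (Fin.castAdd 1 j) = A i j
  simp [embed]

@[simp] theorem embed_castSucc_last (A : Matrix (Fin n) (Fin n) ℝ) (i : Fin n) :
    embed A i.castSucc (Fin.last n) = 0 := by
  simp [embed]

@[simp] theorem embed_last_castSucc (A : Matrix (Fin n) (Fin n) ℝ) (i : Fin n) :
    embed A (Fin.last n) i.castSucc = 0 := by
  simp [embed]

@[simp] theorem embed_last_last (A : Matrix (Fin n) (Fin n) ℝ) :
    embed A (Fin.last n) (Fin.last n) = 1 := by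
  simp [embed]

theorem embed_mul (A B : Matrix (Fin n) (Fin n) ℝ) : embed (A * B) = embed A * embed B := by
  ext i j
  refine Fin.lastCases ?_ (fun i => ?_) i <;> refine Fin.lastCases ?_ (fun j => ?_) j <;>
    simp [Matrix.mul_apply, Fin.sum_univ_castSucc]

theorem embed_one : embed (1 : Matrix (Fin n) (Fin n) ℝ) = 1 := by
  ext i j
  refine Fin.lastCases ?_ (fun i => ?_) i <;> refine Fin.lastCases ?_ (fun j => ?_) j <;>
    simp [Matrix.one_apply, Fin.ext_iff]
  all_goals omega

theorem embed_transpose (A : Matrix (Fin n) (Fin n) ℝ) : embed Aᵀ = (embed A)ᵀ := by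
  ext i j
  refine Fin.lastCases ?_ (fun i => ?_) i <;> refine Fin.lastCases ?_ (fun j => ?_) j <;> simp

theorem embed_injective : Function.Injective (embed (n := n)) := fun A B h => by
  ext i j
  simpa using congrFun (congrFun h i.castSucc) j.castSucc

theorem det_embed (A : Matrix (Fin n) (Fin n) ℝ) : (embed A).det = A.det := by
  simp [embed]

theorem embed_mem_SO {A : Matrix (Fin n) (Fin n) ℝ} : embed A ∈ SO (n + 1) ↔ A ∈ SO n := by
  rw [mem_SO_iff, mem_SO_iff, det_embed, ← embed_transpose, ← embed_mul, ← embed_one,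
    embed_injective.eq_iff]

/-- The upper left block of size `n`. -/
def unembed (A : Matrix (Fin (n + 1)) (Fin (n + 1)) ℝ) : Matrix (Fin n) (Fin n) ℝ :=
  A.submatrix Fin.castSucc Fin.castSucc

@[simp] theorem unembed_embed (A : Matrix (Fin n) (Fin n) ℝ) : unembed (embed A) = A := by
  ext i j
  simp [unembed]

theorem mul_embed_apply_last (R : Matrix (Fin (n + 1)) (Fin (n + 1)) ℝ)
    (A : Matrix (Fin n) (Fin n) ℝ) (i : Fin (n + 1)) :
    (R * embed A) i (Fin.last n) = R i (Fin.last n) := by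
  simp [Matrix.mul_apply, Fin.sum_univ_castSucc]

theorem embed_unembed {A : Matrix (Fin (n + 1)) (Fin (n + 1)) ℝ} (hA : A ∈ SO (n + 1))
    (h : ∀ i, A i (Fin.last n) = (1 : Matrix (Fin (n + 1)) (Fin (n + 1)) ℝ) i (Fin.last n)) :
    embed (unembed A) = A := by
  have h2 : ∀ j, A (Fin.last n) j = (1 : Matrix (Fin (n + 1)) (Fin (n + 1)) ℝ) (Fin.last n) j := by
    intro j
    -- As the last column of `A` is a basis vector, the last row of `Aᵀ * A` is the last row of `A`.
    rw [← (mem_SO_iff.1 hA).1]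
    simp [Matrix.mul_apply, h, Matrix.one_apply]
  ext i j
  refine Fin.lastCases ?_ (fun i => ?_) i <;> refine Fin.lastCases ?_ (fun j => ?_) j
  · simp [h]
  · simp [h2, Fin.ext_iff, j.2.ne']
  · simp [h, Fin.ext_iff, i.2.ne]
  · simp [unembed]

end embed

/-! ### The recursion for the product of rotations. -/

theorem embed_rot {n k : ℕ} (hk : k < n) (t : ℝ) : embed (rot n k t) = rot (n + 1) k t := by
  have h1 : ∀ i j : Fin n, lam (n + 1) k k i.castSucc j.castSucc = lam n k k i j := by
    simp [lam]
  have h2 : ∀ i, lam (n + 1) k k i (Fin.last n) = 0 := by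
    intro i
    simp [lam, hk.ne]
    omega
  have h3 : ∀ i, lam (n + 1) k k (Fin.last n) i = 0 := by
    intro i
    simp [lam, hk.ne]
    omega
  ext i j
  refine Fin.lastCases ?_ (fun i => ?_) i <;> refine Fin.lastCases ?_ (fun j => ?_) j <;>
    simp [rot, Matrix.mul_apply, Fin.sum_univ_castSucc, h1, h2, h3, Matrix.one_apply,
      Fin.ext_iff]
  all_goals omega

/-- Every factor but the last fixes the last basis vector, hence comes from the smaller size. -/
theorem rotProd_succ (n : ℕ) (θ : Fin (n + 1) → ℝ) :
    rotProd (n + 1) θ =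
      embed (rotProd n (Fin.init θ)) * rot (n + 2) (n + 1) (θ (Fin.last n)) := by
  have h : ∀ l : List (Matrix (Fin (n + 1)) (Fin (n + 1)) ℝ),
      embed l.prod = (l.map embed).prod := by
    intro l
    induction l with
    | nil => simp [embed_one]
    | cons a l ih => simp [embed_mul, ih]
  rw [rotProd, List.ofFn_succ', List.concat_eq_append, List.prod_append, List.prod_singleton,
    rotProd, h, List.map_ofFn]
  congr 1
  · congr 2
    ext1 k
    rw [Function.comp_apply, exp_smul_lam (by omega) (by omega), exp_smul_lam (by omega)
      (by omega), embed_rot (by omega)]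
    rfl
  · rw [Fin.val_last, exp_smul_lam (by omega) (by omega)]

theorem rot_apply_last (n : ℕ) (t : ℝ) (i : Fin (n + 2)) :
    rot (n + 2) (n + 1) t i (Fin.last (n + 1)) =
      (Fin.snoc (fun j : Fin (n + 1) => if j = Fin.last n then Real.sin t else 0)
        (Real.cos t) : Fin (n + 2) → ℝ) i := by
  have h : ∀ i : Fin (n + 2), lam (n + 2) (n + 1) (n + 1) i (Fin.last (n + 1)) =
      if i = (Fin.last n).castSucc then 1 else 0 := by
    intro i
    simp [lam, Fin.ext_iff, eq_comm]
  have h' : ∀ i : Fin (n + 2), lam (n + 2) (n + 1) (n + 1) i (Fin.last n).castSucc =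
      if i = Fin.last (n + 1) then -1 else 0 := by
    intro i
    rcases eq_or_ne i (Fin.last (n + 1)) with rfl | hi
    · simp [lam]
    · have := Fin.val_lt_last hi
      simp [lam, hi]
      omega
  have h2 : ∀ i : Fin (n + 2), (lam (n + 2) (n + 1) (n + 1) * lam (n + 2) (n + 1) (n + 1)) i
      (Fin.last (n + 1)) = if i = Fin.last (n + 1) then -1 else 0 := by
    intro i
    simp [Matrix.mul_apply, h, h']
  simp only [rot, Matrix.add_apply, Matrix.smul_apply, h, h2]
  refine Fin.lastCases ?_ (fun i => ?_) i
  · simp [Fin.ext_iff]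
  · simp [Fin.ext_iff, i.2.ne]

/-! ### Smooth inverses on open sets of the ambient space. -/

/-- A map `f` has a smooth inverse between `X` and a relatively open part of `Y` if there are an
open set `V` and a smooth map `g` on `V` that is inverse to `f` between `X` and `V ∩ Y`. -/
def HasSmoothInverse {E F : Type*} [NormedAddCommGroup E] [NormedSpace ℝ E]
    [NormedAddCommGroup F] [NormedSpace ℝ F] (f : E → F) (X : Set E) (Y : Set F) : Prop :=
  ∃ (V : Set F) (g : F → E), IsOpen V ∧ ContDiffOn ℝ ∞ g V ∧
    (∀ x ∈ X, f x ∈ V ∧ g (f x) = x) ∧ ∀ y ∈ V ∩ Y, g y ∈ X ∧ f (g y) = y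

section
variable {E F : Type*} [NormedAddCommGroup E] [NormedSpace ℝ E]
    [NormedAddCommGroup F] [NormedSpace ℝ F] {f : E → F} {X : Set E} {Y : Set F}

theorem HasSmoothInverse.exists_isOpen_image_eq (h : HasSmoothInverse f X Y)
    (hXY : Set.MapsTo f X Y) : ∃ V : Set F, IsOpen V ∧ f '' X = V ∩ Y := by
  obtain ⟨V, g, hV, -, h1, h2⟩ := h
  refine ⟨V, hV, Set.Subset.antisymm ?_ fun y hy => ⟨g y, h2 y hy⟩⟩
  rintro _ ⟨x, hx, rfl⟩
  exact ⟨(h1 x hx).1, hXY hx⟩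

theorem HasSmoothInverse.isDiffeoBetween (h : HasSmoothInverse f X Y) (hf : ContDiff ℝ ∞ f) :
    IsDiffeoBetween f X (f '' X) := by
  obtain ⟨V, g, hV, hg, h1, -⟩ := h
  have hl : Set.LeftInvOn g f X := fun x hx => (h1 x hx).2
  refine ⟨hl.injOn.bijOn_image, fun x _ => ⟨Set.univ, isOpen_univ, trivial, f, hf.contDiffOn,
    fun _ _ => rfl⟩, g, ⟨hl, ?_⟩, ?_⟩
  · rintro _ ⟨x, hx, rfl⟩
    rw [hl hx]
  · rintro _ ⟨x, hx, rfl⟩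
    exact ⟨V, hV, (h1 x hx).1, g, hg, fun _ _ => rfl⟩

end

/-! ### Spherical coordinates. -/

/-- Spherical coordinates on the sphere of dimension `n`. -/
def sph : (n : ℕ) → (Fin n → ℝ) → Fin (n + 1) → ℝ
  -- Only the point `1` of `S^0` occurs, which is why the first angle must run over a full circle.
  | 0, _ => fun _ => 1
  | n + 1, θ => Fin.snoc (Real.sin (θ (Fin.last n)) • sph n (Fin.init θ)) (Real.cos (θ (Fin.last n)))

/-- The right end points `2π, π, …, π` of the intervals of the spherical coordinates. -/
def headMax {n : ℕ} (k : Fin n) : ℝ := if k.val = 0 then 2 * Real.pi else Real.pi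

theorem headMax_castSucc {n : ℕ} (k : Fin n) : headMax k.castSucc = headMax k := rfl

theorem headMax_last (n : ℕ) : headMax (Fin.last (n + 1)) = Real.pi := by
  simp [headMax]

theorem exists_angle {a b : ℝ} (h : a ^ 2 + b ^ 2 = 1) :
    ∃ t ∈ Set.Icc 0 (2 * Real.pi), Real.sin t = a ∧ Real.cos t = b := by
  have h1 : -1 ≤ b := by nlinarith
  have h2 : b ≤ 1 := by nlinarith
  have h3 : 1 - b ^ 2 = a ^ 2 := by linarith
  have h4 := Real.arccos_nonneg b
  have h5 := Real.arccos_le_pi b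
  rcases le_total 0 a with ha | ha
  · exact ⟨Real.arccos b, ⟨h4, by linarith⟩, by
      rw [Real.sin_arccos, h3, Real.sqrt_sq ha], Real.cos_arccos h1 h2⟩
  · refine ⟨2 * Real.pi - Real.arccos b, ⟨by linarith, by linarith⟩, ?_, ?_⟩
    · rw [Real.sin_two_pi_sub, Real.sin_arccos, h3, Real.sqrt_sq_eq_abs, abs_of_nonpos ha, neg_neg]
    · rw [Real.cos_two_pi_sub, Real.cos_arccos h1 h2]

theorem sph_surj (n : ℕ) (v : Fin (n + 2) → ℝ) (hv : ∑ i, v i ^ 2 = 1) :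
    ∃ θ : Fin (n + 1) → ℝ, (∀ k, θ k ∈ Set.Icc 0 (headMax k)) ∧ sph (n + 1) θ = v := by
  induction n with
  | zero =>
    obtain ⟨t, ht, hs, hc⟩ := exists_angle (a := v 0) (b := v 1) (by simpa using hv)
    refine ⟨fun _ => t, fun k => by simpa [headMax] using ht, ?_⟩
    ext i
    fin_cases i
    · simpa [sph, Fin.snoc] using hs
    · simpa [sph, Fin.snoc] using hc
  | succ n ih =>
    obtain ⟨w, c, rfl⟩ : ∃ (w : Fin (n + 2) → ℝ) (c : ℝ), v = Fin.snoc w c :=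
      ⟨Fin.init v, v (Fin.last _), (Fin.snoc_init_self v).symm⟩
    rw [Fin.sum_univ_castSucc] at hv
    simp only [Fin.snoc_castSucc, Fin.snoc_last] at hv
    have h0 : 0 ≤ ∑ i, w i ^ 2 := Finset.sum_nonneg fun i _ => sq_nonneg _
    have h1 : -1 ≤ c := by nlinarith
    have h2 : c ≤ 1 := by nlinarith
    have h3 : 1 - c ^ 2 = ∑ i, w i ^ 2 := by linarith
    -- At the poles `w = 0`, and any unit vector serves as `u`.
    have key : ∃ u : Fin (n + 2) → ℝ, ∑ i, u i ^ 2 = 1 ∧ √(∑ i, w i ^ 2) • u = w := by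
      rcases h0.eq_or_lt with h | h
      · refine ⟨Pi.single 0 1, by simp [Pi.single_apply], ?_⟩
        have := (Finset.sum_eq_zero_iff_of_nonneg fun i _ => sq_nonneg _).1 h.symm
        ext i
        simpa [← h, eq_comm] using this i (Finset.mem_univ i)
      · refine ⟨(√(∑ i, w i ^ 2))⁻¹ • w, ?_, smul_inv_smul₀ (Real.sqrt_pos.2 h).ne' w⟩
        simp only [Pi.smul_apply, smul_eq_mul, mul_pow, ← Finset.mul_sum, inv_pow,
          Real.sq_sqrt h0]
        exact inv_mul_cancel₀ h.ne'
    obtain ⟨u, hu, huw⟩ := key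
    obtain ⟨θ, hθ, rfl⟩ := ih u hu
    refine ⟨Fin.snoc θ (Real.arccos c), fun k => ?_, ?_⟩
    · refine Fin.lastCases ?_ (fun k => ?_) k
      · rw [Fin.snoc_last, headMax_last]
        exact ⟨Real.arccos_nonneg c, Real.arccos_le_pi c⟩
      · rw [Fin.snoc_castSucc, headMax_castSucc]
        exact hθ k
    · rw [sph, Fin.snoc_last, Fin.init_snoc, Real.sin_arccos, h3, huw, Real.cos_arccos h1 h2]

theorem contDiffOn_snoc {E : Type*} [NormedAddCommGroup E] [NormedSpace ℝ E] {n : ℕ}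
    {f : E → Fin n → ℝ} {g : E → ℝ} {s : Set E} (hf : ContDiffOn ℝ ∞ f s)
    (hg : ContDiffOn ℝ ∞ g s) :
    ContDiffOn ℝ ∞ (fun x => (Fin.snoc (f x) (g x) : Fin (n + 1) → ℝ)) s := by
  refine contDiffOn_pi.2 fun i => ?_
  refine Fin.lastCases ?_ (fun i => ?_) i
  · simpa using hg
  · simpa using contDiffOn_pi.1 hf i

/-- Since `sin θ / (1 - cos θ) = cot (θ/2) = tan (π/2 - θ/2)`, the arctangent recovers the angle on
the whole circle minus the point with `cos θ = 1`. -/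
theorem hasSmoothInverse_sph_one :
    HasSmoothInverse (sph 1) {θ | ∀ k, θ k ∈ Set.Ioo 0 (headMax k)} {v | ∑ i, v i ^ 2 = 1} := by
  refine ⟨{x | x 1 < 1}, fun x _ => Real.pi - 2 * Real.arctan (x 0 / (1 - x 1)),
    isOpen_lt (by fun_prop) (by fun_prop), ?_, ?_, ?_⟩
  · refine contDiffOn_pi.2 fun _ => contDiffOn_const.sub (contDiffOn_const.mul
      (Real.contDiff_arctan.comp_contDiffOn (ContDiffOn.div (by fun_prop) (by fun_prop) ?_)))
    intro x hx
    exact (sub_pos.2 hx).ne'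
  · intro θ hθ
    have h0 : 0 < θ 0 ∧ θ 0 < 2 * Real.pi := by simpa [headMax] using hθ 0
    have e0 : sph 1 θ 0 = Real.sin (θ 0) := by simp [sph, Fin.snoc]
    have e1 : sph 1 θ 1 = Real.cos (θ 0) := by simp [sph, Fin.snoc]
    have hs : 0 < Real.sin (θ 0 / 2) := Real.sin_pos_of_pos_of_lt_pi (by linarith) (by linarith)
    have es : Real.sin (θ 0) = 2 * Real.sin (θ 0 / 2) * Real.cos (θ 0 / 2) := by
      rw [← Real.sin_two_mul]; ring_nf
    have ec : 1 - Real.cos (θ 0) = 2 * Real.sin (θ 0 / 2) ^ 2 := by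
      have : Real.cos (θ 0) = Real.cos (2 * (θ 0 / 2)) := by ring_nf
      rw [this, Real.cos_two_mul, Real.cos_sq']; ring
    refine ⟨?_, ?_⟩
    · have : 0 < 1 - Real.cos (θ 0) := by rw [ec]; positivity
      simpa [e1] using this
    · ext k
      obtain rfl : k = 0 := Subsingleton.elim _ _
      have : Real.sin (θ 0) / (1 - Real.cos (θ 0)) = Real.tan (Real.pi / 2 - θ 0 / 2) := by
        rw [es, ec, Real.tan_eq_sin_div_cos, Real.sin_pi_div_two_sub, Real.cos_pi_div_two_sub]
        field_simp
      dsimp only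
      rw [e0, e1, this, Real.arctan_tan (by linarith) (by linarith)]
      ring
  · rintro v ⟨hv1 : v 1 < 1, hv⟩
    have hv : v 0 ^ 2 + v 1 ^ 2 = 1 := by simpa using hv
    have hpos : 0 < 1 - v 1 := sub_pos.2 hv1
    set t := v 0 / (1 - v 1) with ht
    have ht2 : 1 + t ^ 2 = 2 / (1 - v 1) := by
      rw [ht]; field_simp; linear_combination hv
    have ha := Real.arctan_lt_pi_div_two t
    have hb := Real.neg_pi_div_two_lt_arctan t
    have hcc : Real.cos (Real.arctan t) ^ 2 = (1 - v 1) / 2 := by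
      rw [Real.cos_sq_arctan, ht2, one_div_div]
    refine ⟨fun k => ?_, ?_⟩
    · obtain rfl : k = 0 := Subsingleton.elim _ _
      simp only [headMax, Fin.val_zero, if_true]
      constructor <;> linarith
    · ext i
      fin_cases i
      · simp [sph, Fin.snoc, Real.sin_two_mul]
        have : Real.sin (Real.arctan t) = t * Real.cos (Real.arctan t) := by
          rw [← Real.tan_mul_cos (Real.cos_arctan_pos t).ne', Real.tan_arctan]
        rw [this]
        calc _ = 2 * t * Real.cos (Real.arctan t) ^ 2 := by ring
          _ = _ := by rw [hcc, ht]; field_simp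
      · simp [sph, Fin.snoc, Real.cos_two_mul]
        rw [← ht, hcc]
        ring

theorem hasSmoothInverse_sph (n : ℕ) :
    HasSmoothInverse (sph (n + 1)) {θ | ∀ k, θ k ∈ Set.Ioo 0 (headMax k)}
      {v | ∑ i, v i ^ 2 = 1} := by
  induction n with
  | zero => exact hasSmoothInverse_sph_one
  | succ n ih =>
    obtain ⟨V, g, hV, hg, h1, h2⟩ := ih
    set W : Set (Fin (n + 3) → ℝ) := {x | x (Fin.last _) ∈ Set.Ioo (-1) 1} with hWdef
    -- On the sphere this normalizes the first coordinates. The square root is the sine of the last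
    -- angle, which is positive on `(0, π)`.
    set h : (Fin (n + 3) → ℝ) → Fin (n + 2) → ℝ :=
      fun x => (√(1 - x (Fin.last _) ^ 2))⁻¹ • Fin.init x with hhdef
    have hpos : ∀ c : ℝ, c ∈ Set.Ioo (-1 : ℝ) 1 → 0 < 1 - c ^ 2 := by
      rintro c ⟨ha, hb⟩
      nlinarith
    have hW : IsOpen W := isOpen_Ioo.preimage (continuous_apply _)
    have hh : ContDiffOn ℝ ∞ h W := by
      refine ContDiffOn.smul (ContDiffOn.inv (ContDiffOn.sqrt (by fun_prop) ?_) ?_) ?_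
      · exact fun x hx => (hpos _ hx).ne'
      · exact fun x hx => (Real.sqrt_pos.2 (hpos _ hx)).ne'
      · exact contDiffOn_pi.2 fun i => (contDiff_apply ℝ ℝ i.castSucc).contDiffOn
    refine ⟨W ∩ h ⁻¹' V, fun x => Fin.snoc (g (h x)) (Real.arccos (x (Fin.last _))),
      hh.continuousOn.isOpen_inter_preimage hW hV, contDiffOn_snoc ?_ ?_, ?_, ?_⟩
    · exact hg.comp (hh.mono Set.inter_subset_left) fun x hx => hx.2
    · intro x hx
      exact ((Real.contDiffAt_arccos hx.1.1.ne' hx.1.2.ne).comp x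
        (contDiff_apply ℝ ℝ _).contDiffAt).contDiffWithinAt
    · intro θ hθ
      have hl := hθ (Fin.last _)
      rw [headMax_last] at hl
      have hi : ∀ k, (Fin.init θ : Fin (n + 1) → ℝ) k ∈ Set.Ioo 0 (headMax k) :=
        fun k => hθ k.castSucc
      have hs := Real.sin_pos_of_pos_of_lt_pi hl.1 hl.2
      have hc : Real.cos (θ (Fin.last _)) ∈ Set.Ioo (-1 : ℝ) 1 := by
        have := Real.sin_sq_add_cos_sq (θ (Fin.last _))
        constructor <;> nlinarith
      have hsq : √(1 - Real.cos (θ (Fin.last _)) ^ 2) = Real.sin (θ (Fin.last _)) := by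
        rw [← Real.sin_sq, Real.sqrt_sq hs.le]
      have hhθ : h (sph (n + 2) θ) = sph (n + 1) (Fin.init θ) := by
        rw [hhdef]
        simp only [sph, Fin.snoc_last, Fin.init_snoc, hsq]
        exact inv_smul_smul₀ hs.ne' _
      have hlast : sph (n + 2) θ (Fin.last _) = Real.cos (θ (Fin.last _)) := by
        simp [sph]
      refine ⟨⟨?_, ?_⟩, ?_⟩
      · simpa [hWdef, hlast] using hc
      · rw [Set.mem_preimage, hhθ]
        exact (h1 _ hi).1
      · simp only [hhθ, (h1 _ hi).2, hlast, Real.arccos_cos hl.1.le hl.2.le]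
        exact Fin.snoc_init_self θ
    · rintro v ⟨⟨hvW, hvV⟩, hv⟩
      have hc := hpos _ hvW
      have hsum : ∑ i, h v i ^ 2 = 1 := by
        simp only [Set.mem_ofPred_eq] at hv
        rw [Fin.sum_univ_castSucc] at hv
        simp only [hhdef, Pi.smul_apply, smul_eq_mul, mul_pow, ← Finset.mul_sum, inv_pow,
          Real.sq_sqrt hc.le, Fin.init]
        rw [eq_sub_of_add_eq hv]
        exact inv_mul_cancel₀ hc.ne'
      obtain ⟨h3, h4⟩ := h2 _ ⟨hvV, hsum⟩
      dsimp only
      refine ⟨fun k => ?_, ?_⟩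
      · refine Fin.lastCases ?_ (fun k => ?_) k
        · rw [Fin.snoc_last, headMax_last]
          exact ⟨Real.arccos_pos.2 hvW.2, Real.arccos_lt_pi.2 hvW.1⟩
        · rw [Fin.snoc_castSucc, headMax_castSucc]
          exact h3 k
      · rw [sph, Fin.snoc_last, Fin.init_snoc, h4, Real.sin_arccos,
          Real.cos_arccos hvW.1.le hvW.2.le, hhdef]
        simp only [smul_inv_smul₀ (Real.sqrt_pos.2 hc).ne']
        exact Fin.snoc_init_self v

/-! ### The last column as a map from `SO(n+1)` to the sphere. -/

/-- The last rotation sends the last basis vector to `sin t` times its predecessor plus `cos t`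
times itself; the embedded product turns the predecessor into the previous last column. This is the
recursion of `sph`. -/
theorem rotProd_apply_last (n : ℕ) (θ : Fin n → ℝ) (i : Fin (n + 1)) :
    rotProd n θ i (Fin.last n) = sph n θ i := by
  induction n with
  | zero =>
    obtain rfl : i = Fin.last 0 := Fin.ext (by omega)
    simp [rotProd, sph]
  | succ n ih =>
    rw [rotProd_succ, Matrix.mul_apply, Fin.sum_univ_castSucc, rot_apply_last, Fin.snoc_last]
    simp only [rot_apply_last, Fin.snoc_castSucc]
    refine Fin.lastCases ?_ (fun i => ?_) i
    · simp [sph]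
    · simp [sph, ih, mul_comm]

theorem sum_sq_col {n : ℕ} {A : Matrix (Fin n) (Fin n) ℝ} (hA : A ∈ SO n) (j : Fin n) :
    ∑ i, A i j ^ 2 = 1 := by
  have := congrFun (congrFun (mem_SO_iff.1 hA).1 j) j
  simpa [Matrix.mul_apply, ← pow_two] using this

theorem transpose_mul_apply_last {n : ℕ} {R A : Matrix (Fin (n + 1)) (Fin (n + 1)) ℝ}
    (hR : R ∈ SO (n + 1)) (h : ∀ i, R i (Fin.last n) = A i (Fin.last n)) (i : Fin (n + 1)) :
    (Rᵀ * A) i (Fin.last n) = (1 : Matrix (Fin (n + 1)) (Fin (n + 1)) ℝ) i (Fin.last n) := by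
  rw [← (mem_SO_iff.1 hR).1]
  simp [Matrix.mul_apply, h]

/-- If an element of `SO(n+1)` has the same last column as `R`, then it is `R` times an element of
`SO(n)`. -/
theorem mul_embed_unembed {n : ℕ} {R A : Matrix (Fin (n + 1)) (Fin (n + 1)) ℝ}
    (hR : R ∈ SO (n + 1)) (hA : A ∈ SO (n + 1))
    (h : ∀ i, R i (Fin.last n) = A i (Fin.last n)) :
    unembed (Rᵀ * A) ∈ SO n ∧ R * embed (unembed (Rᵀ * A)) = A := by
  have h1 := embed_unembed (mul_mem_SO (transpose_mem_SO hR) hA) (transpose_mul_apply_last hR h)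
  refine ⟨?_, ?_⟩
  · rw [← embed_mem_SO, h1]
    exact mul_mem_SO (transpose_mem_SO hR) hA
  · rw [h1, ← Matrix.mul_assoc, mul_eq_one_comm.1 (mem_SO_iff.1 hR).1, Matrix.one_mul]

theorem unembed_transpose_mul {n : ℕ} {R : Matrix (Fin (n + 1)) (Fin (n + 1)) ℝ}
    (hR : R ∈ SO (n + 1)) (B : Matrix (Fin n) (Fin n) ℝ) :
    unembed (Rᵀ * (R * embed B)) = B := by
  rw [← Matrix.mul_assoc, (mem_SO_iff.1 hR).1, Matrix.one_mul, unembed_embed]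

/-! ### Splitting the angles and the hypercube. -/

/-- The angles for `SO(n+1)` from the first `n` and the remaining ones. -/
def joinAngles (n : ℕ) (θ : Fin n → ℝ) (ψ : Fin (n * (n - 1) / 2) → ℝ) :
    Fin ((n + 1) * (n + 1 - 1) / 2) → ℝ :=
  fun i => Fin.append θ ψ (Fin.cast (angle_count n) i)

@[simp] theorem headAngles_joinAngles (n : ℕ) (θ : Fin n → ℝ) (ψ : Fin (n * (n - 1) / 2) → ℝ) :
    headAngles n (joinAngles n θ ψ) = θ := by
  ext k
  simp [headAngles, joinAngles]

@[simp] theorem tailAngles_joinAngles (n : ℕ) (θ : Fin n → ℝ) (ψ : Fin (n * (n - 1) / 2) → ℝ) :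
    tailAngles n (joinAngles n θ ψ) = ψ := by
  ext k
  simp [tailAngles, joinAngles]

theorem forall_angles_iff {n : ℕ} {p : Fin ((n + 1) * (n + 1 - 1) / 2) → Prop} :
    (∀ i, p i) ↔ (∀ k, p (Fin.cast (angle_count n).symm (Fin.castAdd _ k))) ∧
      ∀ k, p (Fin.cast (angle_count n).symm (Fin.natAdd _ k)) := by
  refine ⟨fun h => ⟨fun _ => h _, fun _ => h _⟩, fun ⟨h1, h2⟩ i => ?_⟩
  obtain ⟨i, rfl⟩ : ∃ j, i = Fin.cast (angle_count n).symm j := ⟨Fin.cast (angle_count n) i, rfl⟩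
  exact Fin.addCases h1 h2 i

@[simp] theorem joinAngles_headAngles_tailAngles (n : ℕ)
    (φ : Fin ((n + 1) * (n + 1 - 1) / 2) → ℝ) :
    joinAngles n (headAngles n φ) (tailAngles n φ) = φ := by
  refine funext (forall_angles_iff.2 ⟨fun k => ?_, fun k => ?_⟩) <;>
    simp [headAngles, tailAngles, joinAngles]

theorem angleMax_succ (n : ℕ) : angleMax (n + 1) = joinAngles n headMax (angleMax n) := rfl

theorem mem_hypercube_succ {n : ℕ} {φ : Fin ((n + 1) * (n + 1 - 1) / 2) → ℝ} :
    φ ∈ hypercube (n + 1) ↔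
      (∀ k, headAngles n φ k ∈ Set.Icc 0 (headMax k)) ∧ tailAngles n φ ∈ hypercube n := by
  simp only [hypercube, Set.mem_univ_pi]
  rw [forall_angles_iff, angleMax_succ]
  simp [joinAngles, headAngles, tailAngles]

theorem mem_interior_hypercube {N : ℕ} {φ : Fin (N * (N - 1) / 2) → ℝ} :
    φ ∈ interior (hypercube N) ↔ ∀ i, φ i ∈ Set.Ioo 0 (angleMax N i) := by
  rw [hypercube, interior_pi_set Set.finite_univ]
  simp only [interior_Icc, Set.mem_univ_pi]

theorem mem_interior_hypercube_succ {n : ℕ} {φ : Fin ((n + 1) * (n + 1 - 1) / 2) → ℝ} :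
    φ ∈ interior (hypercube (n + 1)) ↔
      (∀ k, headAngles n φ k ∈ Set.Ioo 0 (headMax k)) ∧
        tailAngles n φ ∈ interior (hypercube n) := by
  simp only [mem_interior_hypercube]
  rw [forall_angles_iff, angleMax_succ]
  simp [joinAngles, headAngles, tailAngles]

/-! ### Values and surjectivity of `Phi`. -/

theorem Phi_succ (n : ℕ) (φ : Fin ((n + 2) * (n + 2 - 1) / 2) → ℝ) :
    Phi (n + 2) φ =
      rotProd (n + 1) (headAngles (n + 1) φ) * embed (Phi (n + 1) (tailAngles (n + 1) φ)) := rfl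

theorem Phi_mem_SO (N : ℕ) (φ : Fin (N * (N - 1) / 2) → ℝ) : Phi N φ ∈ SO N := by
  match N with
  | 0 => exact one_mem (Matrix.specialOrthogonalGroup (Fin 0) ℝ)
  | 1 => exact one_mem (Matrix.specialOrthogonalGroup (Fin 1) ℝ)
  | n + 2 => exact mul_mem_SO (rotProd_mem_SO _ _) (embed_mem_SO.2 (Phi_mem_SO (n + 1) _))

theorem eq_one_of_mem_SO_one {A : Matrix (Fin 1) (Fin 1) ℝ} (hA : A ∈ SO 1) : A = 1 := by
  have h := (mem_SO_iff.1 hA).2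
  rw [Matrix.det_fin_one] at h
  ext i j
  obtain rfl : i = 0 := Subsingleton.elim _ _
  obtain rfl : j = 0 := Subsingleton.elim _ _
  simp [h]

theorem Phi_surjOn (n : ℕ) : Set.SurjOn (Phi (n + 1)) (hypercube (n + 1)) (SO (n + 1)) := by
  induction n with
  | zero =>
    intro A hA
    exact ⟨fun i => i.elim0, fun i => i.elim0, (eq_one_of_mem_SO_one hA).symm⟩
  | succ n ih =>
    intro A hA
    obtain ⟨θ, hθ, hv⟩ := sph_surj n (fun i => A i (Fin.last _)) (sum_sq_col hA _)
    obtain ⟨hB, hR⟩ := mul_embed_unembed (rotProd_mem_SO (n + 1) θ) hA fun i => by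
      rw [rotProd_apply_last, hv]
    obtain ⟨ψ, hψ, hBψ⟩ := ih hB
    refine ⟨joinAngles (n + 1) θ ψ, mem_hypercube_succ.2 ⟨by simpa using hθ, by simpa using hψ⟩, ?_⟩
    rw [Phi_succ, headAngles_joinAngles, tailAngles_joinAngles, hBψ, hR]

/-! ### Smoothness of matrix-valued maps. -/

section smooth

variable {E : Type*} [NormedAddCommGroup E] [NormedSpace ℝ E] {s : Set E} {n : ℕ}

/-- The norm on matrices is the entrywise sup norm, so the matrix space is an iterated product. -/
theorem contDiffOn_matrix {m : ℕ} {f : E → Matrix (Fin m) (Fin n) ℝ} :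
    ContDiffOn ℝ ∞ f s ↔ ∀ i j, ContDiffOn ℝ ∞ (fun x => f x i j) s :=
  (contDiffOn_pi (𝕜 := ℝ) (F' := fun _ : Fin m => Fin n → ℝ) (Φ := f)).trans
    (forall_congr' fun _ => contDiffOn_pi)

theorem contDiffOn_matrix_mul {f g : E → Matrix (Fin n) (Fin n) ℝ} (hf : ContDiffOn ℝ ∞ f s)
    (hg : ContDiffOn ℝ ∞ g s) : ContDiffOn ℝ ∞ (fun x => f x * g x) s := by
  rw [contDiffOn_matrix] at *
  intro i j
  simp only [Matrix.mul_apply]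
  exact ContDiffOn.sum fun k _ => (hf i k).mul (hg k j)

theorem contDiffOn_embed {f : E → Matrix (Fin n) (Fin n) ℝ} (hf : ContDiffOn ℝ ∞ f s) :
    ContDiffOn ℝ ∞ (fun x => embed (f x)) s := by
  rw [contDiffOn_matrix] at *
  intro i j
  refine Fin.lastCases ?_ (fun i => ?_) i <;> refine Fin.lastCases ?_ (fun j => ?_) j
  · simpa using contDiffOn_const
  · simpa using contDiffOn_const
  · simpa using contDiffOn_const
  · simpa using hf i j

theorem contDiff_rot (N k : ℕ) : ContDiff ℝ ∞ (rot N k) :=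
  (contDiff_const.add (Real.contDiff_sin.smul contDiff_const)).add
    ((contDiff_const.sub Real.contDiff_cos).smul contDiff_const)

theorem contDiff_rotProd (n : ℕ) : ContDiff ℝ ∞ (rotProd n) := by
  induction n with
  | zero =>
    have : rotProd 0 = fun _ => 1 := by
      ext1 θ
      simp [rotProd]
    rw [this]
    exact contDiff_const
  | succ n ih =>
    rw [funext (rotProd_succ n), ← contDiffOn_univ]
    refine contDiffOn_matrix_mul (contDiffOn_embed ?_) ?_
    · exact (ih.comp (contDiff_pi.2 fun i => contDiff_apply ℝ ℝ i.castSucc)).contDiffOn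
    · exact ((contDiff_rot _ _).comp (contDiff_apply ℝ ℝ _)).contDiffOn

theorem contDiff_Phi (N : ℕ) : ContDiff ℝ ∞ (Phi N) := by
  match N with
  | 0 => exact contDiff_const (c := 1)
  | 1 => exact contDiff_const (c := 1)
  | n + 2 =>
    rw [funext (Phi_succ n), ← contDiffOn_univ]
    refine contDiffOn_matrix_mul ?_ (contDiffOn_embed ?_)
    · exact ((contDiff_rotProd _).comp (contDiff_pi.2 fun _ => contDiff_apply ℝ ℝ _)).contDiffOn
    · exact ((contDiff_Phi (n + 1)).comp
        (contDiff_pi.2 fun _ => contDiff_apply ℝ ℝ _)).contDiffOn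

theorem contDiffOn_joinAngles {f : E → Fin n → ℝ} {g : E → Fin (n * (n - 1) / 2) → ℝ}
    (hf : ContDiffOn ℝ ∞ f s) (hg : ContDiffOn ℝ ∞ g s) :
    ContDiffOn ℝ ∞ (fun x => joinAngles n (f x) (g x)) s := by
  rw [contDiffOn_pi, forall_angles_iff]
  simp only [joinAngles, Fin.cast_cast, Fin.cast_eq_self, Fin.append_left, Fin.append_right]
  exact ⟨contDiffOn_pi.1 hf, contDiffOn_pi.1 hg⟩

end smooth

/-! ### The smooth inverse of `Phi`. -/

theorem hasSmoothInverse_Phi (n : ℕ) :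
    HasSmoothInverse (Phi (n + 1)) (interior (hypercube (n + 1))) (SO (n + 1)) := by
  induction n with
  | zero =>
    refine ⟨Set.univ, fun _ i => i.elim0, isOpen_univ, contDiffOn_const, ?_, ?_⟩
    · exact fun x _ => ⟨trivial, funext fun i => i.elim0⟩
    · exact fun A hA => ⟨mem_interior_hypercube.2 fun i => i.elim0,
        (eq_one_of_mem_SO_one hA.2).symm⟩
  | succ n ih =>
    obtain ⟨V, g, hV, hg, h1, h2⟩ := ih
    obtain ⟨U, p, hU, hp, h3, h4⟩ := hasSmoothInverse_sph n
    set col : Matrix (Fin (n + 2)) (Fin (n + 2)) ℝ → Fin (n + 2) → ℝ :=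
      fun A i => A i (Fin.last _) with hcol
    have hcolS : ContDiff ℝ ∞ col := by
      rw [← contDiffOn_univ]
      exact contDiffOn_pi.2 fun i => contDiffOn_matrix.1 contDiffOn_id i _
    -- The fibre component. The transpose stands for the inverse of the rotation, so the formula
    -- makes sense and is smooth for non-orthogonal `A` too, as long as `col A` lies in `U`.
    set h : Matrix (Fin (n + 2)) (Fin (n + 2)) ℝ → Matrix (Fin (n + 1)) (Fin (n + 1)) ℝ :=
      fun A => unembed ((rotProd (n + 1) (p (col A)))ᵀ * A) with hhdef
    have hW : IsOpen (col ⁻¹' U) := hU.preimage hcolS.continuous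
    have hpc : ContDiffOn ℝ ∞ (fun A => p (col A)) (col ⁻¹' U) :=
      hp.comp hcolS.contDiffOn fun _ hA => hA
    have hh : ContDiffOn ℝ ∞ h (col ⁻¹' U) := by
      have hR := contDiffOn_matrix.1 ((contDiff_rotProd (n + 1)).comp_contDiffOn hpc)
      have hRt : ContDiffOn ℝ ∞ (fun A => (rotProd (n + 1) (p (col A)))ᵀ) (col ⁻¹' U) :=
        contDiffOn_matrix.2 fun i j => hR j i
      have := contDiffOn_matrix.1 (contDiffOn_matrix_mul hRt contDiffOn_id)
      exact contDiffOn_matrix.2 fun i j => this i.castSucc j.castSucc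
    refine ⟨col ⁻¹' U ∩ h ⁻¹' V, fun A => joinAngles (n + 1) (p (col A)) (g (h A)),
      hh.continuousOn.isOpen_inter_preimage hW hV, contDiffOn_joinAngles ?_ ?_, ?_, ?_⟩
    · exact hpc.mono Set.inter_subset_left
    · exact hg.comp (hh.mono Set.inter_subset_left) fun A hA => hA.2
    · intro φ hφ
      obtain ⟨hθ, hψ⟩ := mem_interior_hypercube_succ.1 hφ
      have hc : col (Phi (n + 2) φ) = sph (n + 1) (headAngles (n + 1) φ) := by
        ext i
        rw [hcol, Phi_succ]
        dsimp only
        rw [mul_embed_apply_last, rotProd_apply_last]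
      have hhφ : h (Phi (n + 2) φ) = Phi (n + 1) (tailAngles (n + 1) φ) := by
        rw [hhdef]
        dsimp only
        rw [hc, (h3 _ hθ).2, Phi_succ, unembed_transpose_mul (rotProd_mem_SO _ _)]
      refine ⟨⟨?_, ?_⟩, ?_⟩
      · rw [Set.mem_preimage, hc]
        exact (h3 _ hθ).1
      · rw [Set.mem_preimage, hhφ]
        exact (h1 _ hψ).1
      · dsimp only
        rw [hc, hhφ, (h3 _ hθ).2, (h1 _ hψ).2, joinAngles_headAngles_tailAngles]
    · rintro A ⟨⟨hAU, hAV⟩, hA⟩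
      obtain ⟨hθ, hsph⟩ := h4 _ ⟨hAU, sum_sq_col hA _⟩
      obtain ⟨hB, hR⟩ := mul_embed_unembed (rotProd_mem_SO (n + 1) (p (col A))) hA fun i => by
        rw [rotProd_apply_last, hsph]
      obtain ⟨hψ, hBψ⟩ := h2 _ ⟨hAV, hB⟩
      refine ⟨mem_interior_hypercube_succ.2 ⟨by simpa using hθ, by simpa using hψ⟩, ?_⟩
      rw [Phi_succ, headAngles_joinAngles, tailAngles_joinAngles, hBψ, hR]

end EulerSO

end

theorem mainTheorem6 (N : ℕ) (hN : 2 ≤ N) :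
    -- `Φ_N` maps the hypercube onto `SO(N)`
    Set.MapsTo (EulerSO.Phi N) (EulerSO.hypercube N) (EulerSO.SO N) ∧
    Set.SurjOn (EulerSO.Phi N) (EulerSO.hypercube N) (EulerSO.SO N) ∧
    -- on the interior it is a diffeomorphism onto its image, an open subset of `SO(N)`
    (∃ V : Set (Matrix (Fin N) (Fin N) ℝ), IsOpen V ∧
      EulerSO.Phi N '' interior (EulerSO.hypercube N) = V ∩ EulerSO.SO N) ∧
    EulerSO.IsDiffeoBetween (EulerSO.Phi N) (interior (EulerSO.hypercube N))
      (EulerSO.Phi N '' interior (EulerSO.hypercube N)) := by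
  obtain ⟨n, rfl⟩ : ∃ n, N = n + 1 := ⟨N - 1, by omega⟩
  have h := EulerSO.hasSmoothInverse_Phi n
  exact ⟨fun φ _ => EulerSO.Phi_mem_SO _ φ, EulerSO.Phi_surjOn n,
    h.exists_isOpen_image_eq fun φ _ => EulerSO.Phi_mem_SO _ φ,
    h.isDiffeoBetween (EulerSO.contDiff_Phi _)⟩
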